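/- Let $G$ be a group and let $\mu$ be a probability measure on $G$ that is finitely supported, symmetric ($\mu(g)=\mu(g^{-1})$ for every $g\in G$) and generating (the semigroup generated by $\operatorname{supp}\mu$ is $G$). Call a function $h:G\to\mathbb{R}$ harmonic on $(G,\mu)$ if $h(x)=\sum_{s\in\operatorname{supp}\mu}\mu(s)h(xs)$ for every $x\in G$, and write $|x|$ for the word length of $x\in G$ with respect to the generating set $\operatorname{supp}\mu$. Suppose that there is a surjective homomorphism $\psi$ from $G$ onto an infinite virtually cyclic group (an infinite group with a cyclic subgroup of finite index) such that $K=\ker\psi$ is not finitely generated. Then there is a harmonic function $h$ on $(G,\mu)$ that takes only (strictly) positive values, is of at most linear growth ($|h(x)|=O(|x|)$ as $x\to\infty$ in $G$, i.e. as $x$ leaves every finite subset of $G$), and does not factor through $G/K$, that is, $h$ is not the composition of the quotient map $G\to G/K$ with a function $G/K\to\mathbb{R}$. -/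

import Mathlib

noncomputable section

namespace RWGroup

/-- A probability measure `μ` on a group `G` is *generating* if the semigroup generated by its
support is all of `G`. -/
def IsGenerating {G : Type*} [Group G] (μ : PMF G) : Prop :=
  Subsemigroup.closure μ.support = ⊤

/-- A probability measure `μ` on a group `G` is *symmetric* if `μ(g) = μ(g⁻¹)` for every `g`. -/
def IsSymmetric {G : Type*} [Group G] (μ : PMF G) : Prop :=
  ∀ g : G, μ g = μ g⁻¹

/-- The Laplacian `Δf(x) = f(x) - ∑_{s ∈ supp μ} μ(s) f(xs)` of a finitely supported probability
measure `μ` (the sum is the usual finite sum when the support of `μ` is finite). -/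
def laplacian {G : Type*} [Group G] (μ : PMF G) (f : G → ℝ) (x : G) : ℝ :=
  f x - ∑ᶠ s ∈ μ.support, (μ s).toReal * f (x * s)

/-- A function is *harmonic* on `(G, μ)` if it belongs to the kernel of the Laplacian. -/
def IsHarmonic {G : Type*} [Group G] (μ : PMF G) (f : G → ℝ) : Prop :=
  ∀ x : G, laplacian μ f x = 0

/-- The word length of `g` with respect to `S`: the least length of a word in elements of `S`
whose product is `g` (the empty word has product `1`). -/
def wordLength {G : Type*} [Group G] (S : Set G) (g : G) : ℕ :=
  sInf {n : ℕ | ∃ w : List G, w.length = n ∧ (∀ s ∈ w, s ∈ S) ∧ w.prod = g}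

/-- `f` is of *at most linear growth* on `(G, μ)` if `|f(x)| = O(|x|)` as `x → ∞`, where `|x|` is
the word length of `x` with respect to `supp μ`; here `x → ∞` means that `x` leaves every finite
subset of `G`. -/
def AtMostLinearGrowth {G : Type*} [Group G] (μ : PMF G) (f : G → ℝ) : Prop :=
  Asymptotics.IsBigO Filter.cofinite f (fun x : G => (wordLength μ.support x : ℝ))

/-- A group is *virtually cyclic* if it has a cyclic subgroup of finite index. -/
def IsVirtuallyCyclic (H : Type*) [Group H] : Prop :=
  ∃ C : Subgroup H, IsCyclic C ∧ C.FiniteIndex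

/-- `f : G → ℝ` *factors through* `G ⧸ K` if it is the composition of the quotient map
`G → G ⧸ K` with a function on `G ⧸ K`. -/
def FactorsThroughQuotient {G : Type*} [Group G] (K : Subgroup G) (f : G → ℝ) : Prop :=
  ∃ q : G ⧸ K → ℝ, ∀ x : G, f x = q (QuotientGroup.mk x)

end RWGroup

end

open Filter Topology

/-! The walk carries a harmonic height `Λ` that is `K`-invariant, has bounded increments and grows
by 1 under left translation by an element `t`. It comes from the virtually cyclic quotient: an
integer height with increments depending only on a coset of the cyclic subgroup is made harmonic by
solving a Poisson equation on the finite coset space (`exists_harmonicLevel`).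

Suppose `K` were connected to `1` both in an upper half-space `{Λ ≥ a}` and in a lower one. Reading
off generators along paths, `K` would be generated by conjugates of a finite set by powers of `t`
bounded below, and also by powers bounded above; then `K` would be finitely generated. So, after
possibly reversing `Λ`, some `k ∈ K` is cut off from `1` in a half-space, even one low enough to
connect `1` to `t` (`exists_not_conn`).

Normalise that half-space to `{Λ ≥ 0}`. The function `pass` equals `Λ` on the component of `1` and
is at most 0 off it, so its positive part is subharmonic. The function `expLinear δ (pass x)`
dominates `δ` times that positive part, exceeds it by at most 1, and is superharmonic after a number
of steps depending on the point (`exists_barrier`): at low points where `pass` equals `Λ`,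
disconnection makes `pass` fall behind `Λ` with probability bounded below, and for small `δ` this
first-order gain pays for the second-order convexity loss. Hence the iterated averages converge to a
harmonic function within a bounded distance of the positive part of `pass`. It is unbounded on the
powers `t ^ n`, `n ≥ 0`, and bounded on their translates `k * t ^ n`, so it is not `K`-invariant. -/

/-- A finitely supported symmetric step distribution whose support generates the group. -/
structure FiniteWalk (G : Type*) [Group G] where
  S : Finset G
  p : G → ℝ
  p_pos : ∀ s ∈ S, 0 < p s
  sum_p : ∑ s ∈ S, p s = 1
  inv_mem : ∀ s ∈ S, s⁻¹ ∈ S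
  p_inv : ∀ s, p s⁻¹ = p s
  exists_word : ∀ g : G, ∃ w : List G, (∀ s ∈ w, s ∈ S) ∧ w.prod = g

/-! ### Averaging operator and sub- and superharmonic comparison. -/

namespace FiniteWalk

variable {G : Type*} [Group G] (W : FiniteWalk G)

/-- The averaging (Markov) operator of the walk. -/
def avg (f : G → ℝ) (x : G) : ℝ := ∑ s ∈ W.S, W.p s * f (x * s)

lemma avg_le_avg {f g : G → ℝ} {x : G} (h : ∀ s ∈ W.S, f (x * s) ≤ g (x * s)) :
    W.avg f x ≤ W.avg g x :=
  Finset.sum_le_sum fun s hs => mul_le_mul_of_nonneg_left (h s hs) (W.p_pos s hs).le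

lemma avg_affine (f : G → ℝ) (a b : ℝ) (x : G) :
    W.avg (fun y => a + b * f y) x = a + b * W.avg f x := by
  unfold avg
  rw [Finset.mul_sum]
  conv_rhs => rw [← one_mul a, ← W.sum_p, Finset.sum_mul, ← Finset.sum_add_distrib]
  exact Finset.sum_congr rfl fun s _ => by ring

lemma avg_const (a : ℝ) (x : G) : W.avg (fun _ => a) x = a := by
  simpa using W.avg_affine (fun _ => 0) a 0 x

lemma iterate_avg_mono (n : ℕ) {f g : G → ℝ} (h : ∀ x, f x ≤ g x) (x : G) :
    W.avg^[n] f x ≤ W.avg^[n] g x := by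
  induction n generalizing x with
  | zero => exact h x
  | succ n ih =>
    rw [Function.iterate_succ_apply', Function.iterate_succ_apply']
    exact W.avg_le_avg fun s _ => ih _

/-- The iterates of a subharmonic function increase. -/
lemma monotone_iterate_avg {f : G → ℝ} (h : ∀ x, f x ≤ W.avg f x) (x : G) :
    Monotone fun n => W.avg^[n] f x := by
  refine monotone_nat_of_le_succ fun n => ?_
  rw [Function.iterate_succ_apply]
  exact W.iterate_avg_mono n h x

/-- A subharmonic function with bounded iterates has a harmonic majorant, the limit of its
iterates. -/
lemma exists_harmonic_of_subharmonic {f u : G → ℝ} (hf : ∀ x, f x ≤ W.avg f x)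
    (hu : ∀ n x, W.avg^[n] f x ≤ u x) :
    ∃ h : G → ℝ, (∀ x, W.avg h x = h x) ∧ (∀ x, f x ≤ h x) ∧ ∀ x, h x ≤ u x := by
  have hlim : ∀ x, ∃ l, Tendsto (fun n => W.avg^[n] f x) atTop (𝓝 l) := fun x =>
    ⟨_, tendsto_atTop_ciSup (W.monotone_iterate_avg hf x)
      ⟨u x, by rintro _ ⟨n, rfl⟩; exact hu n x⟩⟩
  choose h hh using hlim
  refine ⟨h, fun x => ?_, fun x => ?_, fun x => ?_⟩
  · have h1 : Tendsto (fun n => W.avg (W.avg^[n] f) x) atTop (𝓝 (W.avg h x)) :=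
      tendsto_finsetSum _ fun s _ => (hh (x * s)).const_mul _
    have h2 := (hh x).comp (tendsto_add_atTop_nat 1)
    refine tendsto_nhds_unique h1 (h2.congr fun n => ?_)
    simp only [Function.comp, Function.iterate_succ_apply']
  · exact (W.monotone_iterate_avg hf x).ge_of_tendsto (hh x) 0
  · exact le_of_tendsto' (hh x) fun n => hu n x

/-- If `u` is superharmonic for a number of steps that may depend on the starting point, then it
bounds all iterates of the subharmonic functions below it. -/
lemma iterate_avg_le_of_superharmonic {f u : G → ℝ} (hf : ∀ x, f x ≤ W.avg f x)
    (hfu : ∀ x, f x ≤ u x) (hu : ∀ x, ∃ k, k ≠ 0 ∧ W.avg^[k] u x ≤ u x) (n : ℕ) (x : G) :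
    W.avg^[n] f x ≤ u x := by
  induction n using Nat.strong_induction_on generalizing x with
  | _ n ih =>
    obtain ⟨k, hk, hkx⟩ := hu x
    -- For `n < k`, monotonicity of the iterates replaces `n` by `k`; otherwise `k` steps are split
    -- off and the induction hypothesis bounds the rest.
    rcases lt_or_ge n k with h | h
    · exact ((W.monotone_iterate_avg hf x h.le).trans (W.iterate_avg_mono k hfu x)).trans hkx
    · obtain ⟨m, rfl⟩ := Nat.exists_eq_add_of_le h
      rw [Function.iterate_add_apply]
      exact (W.iterate_avg_mono k (ih m (by omega)) x).trans hkx

section Local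

variable {W} {Λ : G → ℝ} {R : ℝ} {χ u : G → ℝ}

/-- In `k` steps `Λ` moves by at most `k * R`, so the comparison is needed only in that window of
levels. -/
lemma iterate_avg_le_of_local (hlip : ∀ x, ∀ s ∈ W.S, |Λ (x * s) - Λ x| ≤ R)
    (hχ : ∀ x, W.avg χ x = χ x) (k : ℕ) (x : G)
    (h : ∀ y, |Λ y - Λ x| ≤ k * R → u y ≤ χ y) : W.avg^[k] u x ≤ χ x := by
  induction k generalizing x with
  | zero => exact h x (by simp)
  | succ k ih =>
    rw [Function.iterate_succ_apply', ← hχ x]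
    refine W.avg_le_avg fun s hs => ih _ fun y hy => h y ?_
    have h1 := abs_sub_le (Λ y) (Λ (x * s)) (Λ x)
    have h2 := hlip x s hs
    push_cast
    linarith

/-- The walk follows the word `l` with probability at least `q ^ l.length`, so the deficit of `u` at
its endpoint lowers the average by that fraction. -/
lemma iterate_avg_le_sub_of_local (hlip : ∀ x, ∀ s ∈ W.S, |Λ (x * s) - Λ x| ≤ R)
    (hχ : ∀ x, W.avg χ x = χ x) {q : ℝ} (hq : 0 ≤ q) (hqp : ∀ s ∈ W.S, q ≤ W.p s)
    (l : List G) (hl : ∀ s ∈ l, s ∈ W.S) (x : G)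
    (hx : u (x * l.prod) ≤ χ (x * l.prod))
    (h : ∀ y, |Λ y - Λ x| ≤ l.length * R → u y ≤ χ y) :
    W.avg^[l.length] u x ≤ χ x - q ^ l.length * (χ (x * l.prod) - u (x * l.prod)) := by
  induction l generalizing x with
  | nil => simp
  | cons s l ih =>
    classical
    have hs : s ∈ W.S := hl s (by simp)
    have hstep : ∀ s ∈ W.S, ∀ y, |Λ y - Λ (x * s)| ≤ l.length * R → u y ≤ χ y := by
      intro s hs y hy
      refine h y ?_
      have h1 := abs_sub_le (Λ y) (Λ (x * s)) (Λ x)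
      have h2 := hlip x s hs
      rw [List.length_cons]
      push_cast
      linarith
    rw [List.prod_cons, ← mul_assoc] at hx ⊢
    have key := ih (fun s hs => hl s (by simp [hs])) (x * s) hx (hstep s hs)
    rw [List.length_cons, Function.iterate_succ_apply', ← hχ x]
    rw [avg, avg, ← Finset.add_sum_erase _ _ hs, ← Finset.add_sum_erase _ _ hs]
    have h1 : ∑ r ∈ W.S.erase s, W.p r * W.avg^[l.length] u (x * r) ≤
        ∑ r ∈ W.S.erase s, W.p r * χ (x * r) := Finset.sum_le_sum fun r hr =>
      mul_le_mul_of_nonneg_left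
        (iterate_avg_le_of_local hlip hχ _ _ (hstep r (Finset.mem_of_mem_erase hr)))
        (W.p_pos r (Finset.mem_of_mem_erase hr)).le
    have h2 := mul_le_mul_of_nonneg_left key (W.p_pos s hs).le
    have h3 : q * (q ^ l.length * (χ (x * s * l.prod) - u (x * s * l.prod))) ≤
        W.p s * (q ^ l.length * (χ (x * s * l.prod) - u (x * s * l.prod))) :=
      mul_le_mul_of_nonneg_right (hqp s hs) (mul_nonneg (pow_nonneg hq _) (sub_nonneg.2 hx))
    rw [pow_succ']
    linarith

end Local

end FiniteWalk

/-! ### One-variable estimates for the barrier profile. -/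

/-- Affine with slope `δ` on the positive half-line, exponential with rate `δ` on the negative. -/
noncomputable def expLinear (δ s : ℝ) : ℝ := if 0 ≤ s then 1 + δ * s else Real.exp (δ * s)

section expLinear

variable {δ : ℝ}

lemma expLinear_of_nonneg {s : ℝ} (hs : 0 ≤ s) : expLinear δ s = 1 + δ * s := if_pos hs

lemma expLinear_of_nonpos {s : ℝ} (hs : s ≤ 0) : expLinear δ s = Real.exp (δ * s) := by
  rcases hs.lt_or_eq with h | rfl
  · exact if_neg h.not_ge
  · simp [expLinear]

lemma expLinear_le_exp (s : ℝ) : expLinear δ s ≤ Real.exp (δ * s) := by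
  rcases le_total 0 s with h | h
  · rw [expLinear_of_nonneg h]; linarith [Real.add_one_le_exp (δ * s)]
  · exact (expLinear_of_nonpos h).le

lemma expLinear_mono (hδ : 0 ≤ δ) : Monotone (expLinear δ) := by
  intro a b hab
  rcases le_total 0 a with ha | ha
  · rw [expLinear_of_nonneg ha, expLinear_of_nonneg (ha.trans hab)]
    gcongr
  rcases le_total 0 b with hb | hb
  · rw [expLinear_of_nonneg hb, expLinear_of_nonpos ha]
    have : Real.exp (δ * a) ≤ 1 := Real.exp_le_one_iff.2 (mul_nonpos_of_nonneg_of_nonpos hδ ha)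
    have := mul_nonneg hδ hb
    linarith
  · rw [expLinear_of_nonpos ha, expLinear_of_nonpos hb]
    gcongr

lemma mul_max_le_expLinear (s : ℝ) : δ * max s 0 ≤ expLinear δ s := by
  rcases le_total 0 s with h | h
  · rw [expLinear_of_nonneg h, max_eq_left h]; linarith
  · rw [expLinear_of_nonpos h, max_eq_right h, mul_zero]; positivity

lemma expLinear_le_mul_max (hδ : 0 ≤ δ) (s : ℝ) : expLinear δ s ≤ 1 + δ * max s 0 := by
  rw [← expLinear_of_nonneg (le_max_right s 0)]
  exact expLinear_mono hδ (le_max_left _ _)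

lemma exp_le_quadratic {y : ℝ} (hy : |y| ≤ 1) : Real.exp y ≤ 1 + y + y ^ 2 := by
  have := (abs_le.1 (Real.abs_exp_sub_one_sub_id_le hy)).2
  linarith

/-- The factor `min 1 (exp (δ * τ))` is the slope at `τ` divided by `δ`. The second-order error
carries the same factor, so gain and loss stay comparable as `τ` tends to `-∞`. -/
lemma expLinear_le_taylor (hδ : 0 ≤ δ) {τ s T D : ℝ} (hT : 0 ≤ T) (hτ : τ ≤ T)
    (hs : |s - τ| ≤ D) (hδB : δ * (T + D) ≤ 1) :
    expLinear δ s ≤ expLinear δ τ +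
      min 1 (Real.exp (δ * τ)) * (δ * (s - τ) + δ ^ 2 * (T + D) ^ 2) := by
  have hD : 0 ≤ D := (abs_nonneg _).trans hs
  have bound : ∀ y : ℝ, |y| ≤ T + D → Real.exp (δ * y) ≤ 1 + δ * y + δ ^ 2 * (T + D) ^ 2 := by
    intro y hy
    have h1 : |δ * y| ≤ δ * (T + D) := by
      rw [abs_mul, abs_of_nonneg hδ]; gcongr
    have h2 := exp_le_quadratic (h1.trans hδB)
    have h3 : (δ * y) ^ 2 ≤ (δ * (T + D)) ^ 2 := sq_le_sq' (abs_le.1 h1).1 (abs_le.1 h1).2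
    rw [mul_pow δ (T + D)] at h3
    linarith
  rcases le_total 0 τ with h | h
  · have hm : (1 : ℝ) ≤ Real.exp (δ * τ) := Real.one_le_exp (mul_nonneg hδ h)
    rw [min_eq_left hm, expLinear_of_nonneg h, one_mul]
    have h1 := (expLinear_le_exp (δ := δ) s).trans (bound s ?_)
    · linarith
    · have := abs_le.1 hs
      rw [abs_le]; constructor <;> linarith
  · have hm : Real.exp (δ * τ) ≤ 1 :=
      Real.exp_le_one_iff.2 (mul_nonpos_of_nonneg_of_nonpos hδ h)
    rw [min_eq_right hm, expLinear_of_nonpos h]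
    have h1 := mul_le_mul_of_nonneg_left (bound (s - τ) (by linarith)) (Real.exp_pos (δ * τ)).le
    have h2 := expLinear_le_exp (δ := δ) s
    rw [← Real.exp_add, ← mul_add, add_sub_cancel] at h1
    linarith

lemma le_expLinear_sub (hδ : 0 ≤ δ) (hδ' : δ ≤ 1 / 2) (s : ℝ) :
    δ / 2 * min 1 (Real.exp (δ * s)) ≤ expLinear δ s - expLinear δ (s - 1) := by
  have hsq : δ ^ 2 ≤ δ / 2 := by nlinarith
  rcases le_total 0 s with h | h
  · rw [min_eq_left (Real.one_le_exp (mul_nonneg hδ h)), expLinear_of_nonneg h]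
    rcases le_total 0 (s - 1) with h1 | h1
    · rw [expLinear_of_nonneg h1]; linarith
    · rw [expLinear_of_nonpos h1]
      have h2 : |δ * (s - 1)| ≤ δ := by
        rw [abs_mul, abs_of_nonneg hδ, abs_of_nonpos h1]; nlinarith
      have h3 := exp_le_quadratic (h2.trans (by linarith))
      have h4 := sq_le_sq' (abs_le.1 h2).1 (abs_le.1 h2).2
      nlinarith
  · rw [min_eq_right (Real.exp_le_one_iff.2 (mul_nonpos_of_nonneg_of_nonpos hδ h)),
      expLinear_of_nonpos h, expLinear_of_nonpos (by linarith : s - 1 ≤ 0),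
      show δ * (s - 1) = δ * s + -δ by ring, Real.exp_add]
    have h3 := exp_le_quadratic (y := -δ) (by rw [abs_neg, abs_of_nonneg hδ]; linarith)
    have := mul_le_mul_of_nonneg_left h3 (Real.exp_pos (δ * s)).le
    have := mul_le_mul_of_nonneg_left hsq (Real.exp_pos (δ * s)).le
    nlinarith

/-- Going down by `D ≤ 1 / δ` reduces the slope by a factor of at most `e < 3`, which turns `δ / 2`
into `δ / 6`. -/
lemma le_expLinear_sub_of_le (hδ : 0 ≤ δ) (hδ' : δ ≤ 1 / 2) {τ s D : ℝ} (hD : δ * D ≤ 1)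
    (hs : τ - D ≤ s) :
    δ / 6 * min 1 (Real.exp (δ * τ)) ≤ expLinear δ s - expLinear δ (s - 1) := by
  refine le_trans ?_ (le_expLinear_sub hδ hδ' s)
  have he : Real.exp (δ * τ) ≤ 3 * Real.exp (δ * s) := by
    calc Real.exp (δ * τ) ≤ Real.exp (1 + δ * s) := by
          gcongr; nlinarith
      _ = Real.exp 1 * Real.exp (δ * s) := Real.exp_add _ _
      _ ≤ _ := by gcongr; linarith [Real.exp_one_lt_d9]
  have : min 1 (Real.exp (δ * τ)) ≤ 3 * min 1 (Real.exp (δ * s)) := by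
    rcases min_choice 1 (Real.exp (δ * s)) with h | h <;> rw [h]
    · exact (min_le_left _ _).trans (by norm_num)
    · exact (min_le_right _ _).trans he
  nlinarith

end expLinear

/-! ### Level functions, connectivity in half-spaces, and passes. -/

/-- A harmonic function `Λ` invariant under left translation by `K`, shifted by `1` under left
translation by `t`, with bounded increments, where `K` and `t` act cofinitely on the left. -/
structure HarmonicLevel {G : Type*} [Group G] (W : FiniteWalk G) (K : Subgroup G) where
  Λ : G → ℝ
  t : G
  R : ℝ
  reps : Finset G
  harm : ∀ x, W.avg Λ x = Λ x
  ker_mul : ∀ k ∈ K, ∀ x, Λ (k * x) = Λ x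
  t_mul : ∀ x, Λ (t * x) = Λ x + 1
  lip : ∀ x, ∀ s ∈ W.S, |Λ (x * s) - Λ x| ≤ R
  decomp : ∀ x, ∃ k ∈ K, ∃ n : ℤ, ∃ r ∈ reps, x = k * t ^ n * r

namespace HarmonicLevel

variable {G : Type*} [Group G] {W : FiniteWalk G} {K : Subgroup G} (L : HarmonicLevel W K)

lemma zpow_mul (n : ℤ) (x : G) : L.Λ (L.t ^ n * x) = L.Λ x + n := by
  induction n with
  | zero => simp
  | succ n ih =>
    rw [add_comm, zpow_add, zpow_one, mul_assoc, L.t_mul, ih]; push_cast; ring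
  | pred n ih =>
    have := L.t_mul (L.t ^ (-(n : ℤ) - 1) * x)
    rw [← mul_assoc, ← zpow_one_add, add_sub_cancel, ih] at this
    push_cast at this ⊢; linarith

/-- The level function with its direction reversed. -/
def neg : HarmonicLevel W K where
  Λ x := -L.Λ x
  t := L.t⁻¹
  R := L.R
  reps := L.reps
  harm x := by simpa [L.harm] using W.avg_affine L.Λ 0 (-1) x
  ker_mul k hk x := by rw [L.ker_mul k hk]
  t_mul x := by
    have := L.zpow_mul (-1) x
    rw [zpow_neg_one] at this
    rw [this]; push_cast; ring
  lip x s hs := by rw [neg_sub_neg, abs_sub_comm]; exact L.lip x s hs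
  decomp x := by
    obtain ⟨k, hk, n, r, hr, h⟩ := L.decomp x
    exact ⟨k, hk, -n, r, hr, by simpa using h⟩

/-- The level function plus a constant. -/
def shift (b : ℝ) : HarmonicLevel W K where
  Λ x := b + L.Λ x
  t := L.t
  R := L.R
  reps := L.reps
  harm x := by simpa [L.harm] using W.avg_affine L.Λ b 1 x
  ker_mul k hk x := by rw [L.ker_mul k hk]
  t_mul x := by rw [L.t_mul]; ring
  lip x s hs := by simpa using L.lip x s hs
  decomp := L.decomp

/-- Two group elements are connected above level `a` if a path of the Cayley graph joins them
without leaving `{Λ ≥ a}`. -/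
def Conn (a : ℝ) : G → G → Prop :=
  Relation.ReflTransGen fun x y => a ≤ L.Λ x ∧ a ≤ L.Λ y ∧ ∃ s ∈ W.S, y = x * s

variable {L} {a b : ℝ} {x y z : G}

lemma Conn.mono (h : L.Conn a x y) (hab : b ≤ a) : L.Conn b x y :=
  Relation.ReflTransGen.mono (fun _ _ h => ⟨hab.trans h.1, hab.trans h.2.1, h.2.2⟩) _ _ h

lemma Conn.symm (h : L.Conn a x y) : L.Conn a y x := by
  induction h with
  | refl => exact Relation.ReflTransGen.refl
  | tail _ h ih =>
    obtain ⟨h1, h2, s, hs, rfl⟩ := h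
    exact Relation.ReflTransGen.head ⟨h2, h1, s⁻¹, W.inv_mem s hs, by group⟩ ih

lemma Conn.trans (h : L.Conn a x y) (h' : L.Conn a y z) : L.Conn a x z :=
  Relation.ReflTransGen.trans h h'

lemma Conn.step {s : G} (hs : s ∈ W.S) (h1 : a ≤ L.Λ x) (h2 : a ≤ L.Λ (x * s)) :
    L.Conn a x (x * s) :=
  Relation.ReflTransGen.single ⟨h1, h2, s, hs, rfl⟩

lemma Conn.translate (h : L.Conn a x y) {g : G} {m : ℝ} (hg : ∀ z, L.Λ (g * z) = L.Λ z + m) :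
    L.Conn (a + m) (g * x) (g * y) := by
  induction h with
  | refl => exact Relation.ReflTransGen.refl
  | tail _ h ih =>
    obtain ⟨h1, h2, s, hs, rfl⟩ := h
    exact ih.tail ⟨by rw [hg]; linarith, by rw [hg]; linarith, s, hs, by group⟩

lemma Conn.of_shift {c : ℝ} (h : (L.shift c).Conn (a + c) x y) : L.Conn a x y := by
  refine Relation.ReflTransGen.mono (fun u v huv => ?_) _ _ h
  obtain ⟨h1, h2, h3⟩ := huv
  simp only [shift] at h1 h2
  exact ⟨by linarith, by linarith, h3⟩

lemma Conn.shift {c : ℝ} (h : L.Conn a x y) : (L.shift c).Conn (a + c) x y := by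
  refine Relation.ReflTransGen.mono (fun u v huv => ?_) _ _ h
  obtain ⟨h1, h2, h3⟩ := huv
  exact ⟨by simp only [HarmonicLevel.shift]; linarith, by simp only [HarmonicLevel.shift]; linarith,
    h3⟩

variable (L)

lemma exists_conn (x y : G) : ∃ a, L.Conn a x y := by
  suffices H : ∀ l : List G, (∀ s ∈ l, s ∈ W.S) → ∀ x, ∃ a, L.Conn a x (x * l.prod) by
    obtain ⟨l, hl, hp⟩ := W.exists_word (x⁻¹ * y)
    simpa [hp] using H l hl x
  intro l
  induction l with
  | nil => exact fun _ x => ⟨0, by rw [List.prod_nil, mul_one]; exact Relation.ReflTransGen.refl⟩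
  | cons s l ih =>
    intro hl x
    obtain ⟨a, ha⟩ := ih (fun s hs => hl s (by simp [hs])) (x * s)
    rw [List.prod_cons, ← mul_assoc]
    exact ⟨min a (min (L.Λ x) (L.Λ (x * s))),
      (Conn.step (hl s (by simp)) (by simp) (by simp)).trans (ha.mono (by simp))⟩

lemma R_nonneg : 0 ≤ L.R := by
  obtain ⟨s, hs⟩ : W.S.Nonempty := by
    rw [Finset.nonempty_iff_ne_empty]
    intro h
    simpa [h] using W.sum_p
  exact (abs_nonneg _).trans (L.lip 1 s hs)

/-- Levels `a` below `x` such that `x` is connected to `1` above level `min a 0`. -/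
def admissible (x : G) : Set ℝ := {a | a ≤ L.Λ x ∧ L.Conn (min a 0) x 1}

/-- On the component of `1` in `{Λ ≥ 0}` this is `Λ`; elsewhere it is the height of the highest
pass on the way to that component. -/
noncomputable def pass (x : G) : ℝ := sSup (L.admissible x)

lemma admissible_bddAbove (x : G) : BddAbove (L.admissible x) := ⟨L.Λ x, fun _ h => h.1⟩

lemma admissible_nonempty (x : G) : (L.admissible x).Nonempty := by
  obtain ⟨a, ha⟩ := L.exists_conn x 1
  exact ⟨min a (L.Λ x), min_le_right _ _, ha.mono ((min_le_left _ _).trans (min_le_left _ _))⟩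

variable {L}

lemma le_pass (h : a ∈ L.admissible x) : a ≤ L.pass x := le_csSup (L.admissible_bddAbove x) h

lemma exists_admissible (h : b < L.pass x) : ∃ a ∈ L.admissible x, b < a :=
  exists_lt_of_lt_csSup (L.admissible_nonempty x) h

variable (L)

lemma pass_le (x : G) : L.pass x ≤ L.Λ x := csSup_le (L.admissible_nonempty x) fun _ h => h.1

variable {L}

lemma pass_eq (h : L.Conn 0 x 1) : L.pass x = L.Λ x :=
  (L.pass_le x).antisymm (le_pass ⟨le_rfl, h.mono (min_le_right _ _)⟩)

lemma conn_of_pass_pos (h : 0 < L.pass x) : L.Conn 0 x 1 := by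
  obtain ⟨a, ha, h0⟩ := exists_admissible h
  simpa [min_eq_right h0.le] using ha.2

/-- Away from the points where it equals `Λ`, `pass` does not increase along edges. -/
lemma pass_step_le {s : G} (hs : s ∈ W.S) (h : L.pass x < L.Λ x) :
    L.pass (x * s) ≤ L.pass x := by
  by_contra! hlt
  obtain ⟨b, hb, hxb⟩ := exists_admissible hlt
  -- A higher pass at `x * s`, capped at `Λ x`, would be admissible at `x` too.
  refine (lt_min hxb h).not_ge (le_pass ⟨min_le_right _ _, ?_⟩)
  refine (Conn.step hs ?_ ?_).trans (hb.2.mono ?_)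
  · exact (min_le_left _ _).trans (min_le_right _ _)
  · exact (min_le_left _ _).trans ((min_le_left _ _).trans hb.1)
  · exact min_le_min_right _ (min_le_left _ _)

/-- Above the level of one step, inside the component of `1`, `pass` equals `Λ` after a step. -/
lemma pass_step_eq {s : G} (hs : s ∈ W.S) (hx : 0 < L.pass x) (h : L.R ≤ L.Λ x) :
    L.pass (x * s) = L.Λ (x * s) := by
  refine pass_eq ((Conn.step hs ?_ ?_).symm.trans (conn_of_pass_pos hx))
  · exact L.R_nonneg.trans h
  · linarith [(abs_le.1 (L.lip x s hs)).1]

/-- A neighbour of a point in the component of `1` either lies in that component or has negative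
level, so on the component the positive part of `pass` dominates `Λ` after a step. -/
lemma le_avg_max_pass (x : G) : max (L.pass x) 0 ≤ W.avg (fun y => max (L.pass y) 0) x := by
  rcases le_or_gt (L.pass x) 0 with h | h
  · rw [max_eq_right h, ← W.avg_const 0 x]
    refine W.avg_le_avg fun s _ => ?_
    rw [W.avg_const]
    exact le_max_right _ _
  · have hc := conn_of_pass_pos h
    rw [max_eq_left h.le, pass_eq hc, ← L.harm x]
    refine W.avg_le_avg fun s hs => ?_
    rcases le_or_gt 0 (L.Λ (x * s)) with h' | h'
    · rw [pass_eq ((Conn.step hs (h.le.trans (L.pass_le x)) h').symm.trans hc)]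
      exact le_max_left _ _
    · exact h'.le.trans (le_max_right _ _)

/-! ### The barrier and the harmonic function of a disconnected half-space. -/

variable (L)

/-- If `1` and `k ∈ K` are disconnected in `{Λ ≥ 0}`, then from every low point boundedly many
steps lead to a point where `pass` is smaller than `Λ` by a definite amount. -/
lemma exists_word_pass_le {k : G} (hk : k ∈ K) (h1 : 1 ≤ L.Λ 1) (hk1 : ¬ L.Conn 0 1 k) :
    ∃ N : ℕ, ∀ x, L.Λ x ≤ L.R → ∃ l : List G, l.length ≤ N ∧ (∀ s ∈ l, s ∈ W.S) ∧
      L.pass (x * l.prod) ≤ L.Λ (x * l.prod) - 1 := by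
  classical
  choose word hword hprod using W.exists_word
  obtain ⟨M, hM⟩ : ∃ M : ℤ, ∀ r ∈ L.reps, L.R - L.Λ r ≤ M := by
    obtain ⟨B, hB⟩ := (L.reps.image fun r => L.R - L.Λ r).bddAbove
    exact ⟨⌈B⌉, fun r hr => (hB (by
      simp only [Finset.coe_image, Set.mem_image, SetLike.mem_coe]
      exact ⟨r, hr, rfl⟩)).trans (Int.le_ceil B)⟩
  -- This element leads from `κ * t ^ n * r` to `γ * v`. It depends only on `r` and `v`, which
  -- bounds the word lengths uniformly in `x`.
  let g : G → G → G := fun r v => r⁻¹ * L.t ^ (-M) * v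
  refine ⟨L.reps.sup fun r => max (word (g r 1)).length (word (g r k)).length, fun x hx => ?_⟩
  obtain ⟨κ, hκ, n, r, hr, rfl⟩ := L.decomp x
  have hN := Finset.le_sup (f := fun r => max (word (g r 1)).length (word (g r k)).length) hr
  set γ : G := κ * L.t ^ (n - M) with hγ
  have hγΛ : ∀ z, L.Λ (γ * z) = L.Λ z + (n - M : ℤ) := fun z => by
    rw [hγ, mul_assoc, L.ker_mul κ hκ, L.zpow_mul]
  have hg : ∀ v, κ * L.t ^ n * r * g r v = γ * v := fun v => by
    simp only [g, hγ, zpow_sub, zpow_neg]; group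
  rw [mul_assoc, L.ker_mul κ hκ, L.zpow_mul] at hx
  have hnM : (n : ℝ) ≤ M := by linarith [hM r hr]
  have hkΛ : L.Λ k = L.Λ 1 := by simpa using L.ker_mul k hk 1
  -- If neither `γ` nor `γ * k` works, both are connected to `1` above level `n - M ≤ 0`; here `1 ≤
  -- Λ 1` absorbs the loss of 1. Translating by `γ⁻¹` would connect `1` to `k` in `{Λ ≥ 0}`.
  by_contra! hcon
  have c1 := hcon _ ((le_max_left _ _).trans hN) (hword _)
  have c2 := hcon _ ((le_max_right _ _).trans hN) (hword _)
  rw [hprod, hg, hγΛ] at c1 c2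
  rw [hkΛ] at c2
  obtain ⟨b1, hb1, hlt1⟩ := exists_admissible c1
  obtain ⟨b2, hb2, hlt2⟩ := exists_admissible c2
  push_cast at hlt1 hlt2
  have h0 : ((n : ℝ) - M) ≤ 0 := by linarith
  have d1 := hb1.2.mono (b := n - M) (le_min (by linarith) h0)
  have d2 := hb2.2.mono (b := n - M) (le_min (by linarith) h0)
  have hinv : ∀ z, L.Λ (γ⁻¹ * z) = L.Λ z + -((n : ℝ) - M) := fun z => by
    have := hγΛ (γ⁻¹ * z)
    rw [mul_inv_cancel_left] at this
    push_cast at this; linarith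
  have := (d1.trans d2.symm).translate hinv
  rw [add_neg_cancel, inv_mul_cancel_left, inv_mul_cancel_left] at this
  exact hk1 this

/-- A superharmonic barrier for the disconnected half-space. -/
lemma exists_barrier {k : G} (hk : k ∈ K) (h1 : 1 ≤ L.Λ 1) (hk1 : ¬ L.Conn 0 1 k) :
    ∃ δ : ℝ, 0 < δ ∧ ∀ x, ∃ n, n ≠ 0 ∧
      W.avg^[n] (fun y => expLinear δ (L.pass y)) x ≤ expLinear δ (L.pass x) := by
  obtain ⟨N, hN⟩ := L.exists_word_pass_le hk h1 hk1
  obtain ⟨q, hq, hq1, hqp⟩ : ∃ q : ℝ, 0 < q ∧ q ≤ 1 ∧ ∀ s ∈ W.S, q ≤ W.p s := by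
    rcases W.S.eq_empty_or_nonempty with h | h
    · exact ⟨1, one_pos, le_rfl, by simp [h]⟩
    · obtain ⟨s, hs, hmin⟩ := W.S.exists_min_image W.p h
      refine ⟨W.p s, W.p_pos s hs, ?_, hmin⟩
      rw [← W.sum_p]
      exact Finset.single_le_sum (fun r hr => (W.p_pos r hr).le) hs
  have hR := L.R_nonneg
  set B : ℝ := L.R + N * L.R + 1 with hB
  have hNR : 0 ≤ N * L.R := mul_nonneg (Nat.cast_nonneg _) hR
  have hB1 : 1 ≤ B := by linarith
  -- Chosen so that the loss `c * δ ^ 2 * B ^ 2` equals the guaranteed gain `q ^ N * (δ / 6 * c)`.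
  set δ : ℝ := q ^ N / (6 * B ^ 2) with hδ
  have hqN : 0 < q ^ N := pow_pos hq N
  have hqN1 : q ^ N ≤ 1 := pow_le_one₀ hq.le hq1
  have hδ0 : 0 < δ := by positivity
  have hδB2 : δ * B ^ 2 = q ^ N / 6 := by rw [hδ]; field_simp
  have hδB : δ * B ≤ 1 / 6 := by nlinarith
  have hδ2 : δ ≤ 1 / 6 := by nlinarith
  have hmono := expLinear_mono hδ0.le
  refine ⟨δ, hδ0, fun x => ?_⟩
  rcases (L.pass_le x).lt_or_eq with hlt | heq
  · refine ⟨1, one_ne_zero, ?_⟩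
    rw [Function.iterate_one, ← W.avg_const (expLinear δ (L.pass x)) x]
    exact W.avg_le_avg fun s hs => hmono (pass_step_le hs hlt)
  rcases lt_or_ge L.R (L.Λ x) with hRx | hRx
  · refine ⟨1, one_ne_zero, ?_⟩
    have hpos : 0 < L.pass x := by linarith
    rw [Function.iterate_one, expLinear_of_nonneg hpos.le, heq, ← L.harm x, ← W.avg_affine]
    refine W.avg_le_avg fun s hs => ?_
    rw [pass_step_eq hs hpos hRx.le, expLinear_of_nonneg]
    linarith [(abs_le.1 (L.lip x s hs)).1]
  · obtain ⟨l, hl, hlS, hpass⟩ := hN x hRx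
    refine ⟨l.length, ?_, ?_⟩
    · intro h0
      rw [List.length_eq_zero_iff.1 h0, List.prod_nil, mul_one] at hpass
      linarith
    set τ := L.Λ x
    set c := min 1 (Real.exp (δ * τ)) with hc
    have hc0 : 0 < c := lt_min one_pos (Real.exp_pos _)
    set D : ℝ := l.length * L.R with hD
    have hDN : D ≤ N * L.R := by rw [hD]; gcongr
    have hD0 : 0 ≤ D := by positivity
    have hRD : L.R + D ≤ B := by linarith
    -- The affine function of `Λ` with slope `c * δ` through the value at `τ`, raised by the
    -- second-order error: harmonic, and above the barrier in the window.
    let χ : G → ℝ := fun y => (expLinear δ τ + c * (δ ^ 2 * B ^ 2 - δ * τ)) + c * δ * L.Λ y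
    have hχ : ∀ y, W.avg χ y = χ y := fun y => by
      simp only [χ]; rw [W.avg_affine, L.harm]
    have hlevel : ∀ y, |L.Λ y - τ| ≤ D → expLinear δ (L.Λ y) ≤ χ y := by
      intro y hy
      have h2 : δ ^ 2 * (L.R + D) ^ 2 ≤ δ ^ 2 * B ^ 2 := by gcongr
      have h3 := expLinear_le_taylor hδ0.le hR hRx hy (by nlinarith)
      have h4 := mul_le_mul_of_nonneg_left h2 hc0.le
      simp only [χ]
      rw [← hc] at h3
      linarith
    have hpassχ : ∀ y, |L.Λ y - τ| ≤ D → expLinear δ (L.pass y) ≤ χ y := fun y hy =>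
      (hmono (L.pass_le y)).trans (hlevel y hy)
    have hend : |L.Λ (x * l.prod) - τ| ≤ D := by
      have : ∀ (l : List G), (∀ s ∈ l, s ∈ W.S) → ∀ x,
          |L.Λ (x * l.prod) - L.Λ x| ≤ l.length * L.R := by
        intro l
        induction l with
        | nil => simp
        | cons s l ih =>
          intro hl x
          have h1 := ih (fun s hs => hl s (by simp [hs])) (x * s)
          have h2 := L.lip x s (hl s (by simp))
          have h3 := abs_sub_le (L.Λ (x * s * l.prod)) (L.Λ (x * s)) (L.Λ x)
          rw [List.prod_cons, ← mul_assoc, List.length_cons]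
          push_cast
          linarith
      exact this l hlS x
    have key := FiniteWalk.iterate_avg_le_sub_of_local L.lip hχ hq.le hqp l hlS x
      (u := fun y => expLinear δ (L.pass y)) (hpassχ _ hend) hpassχ
    have hgain : δ / 6 * c ≤ χ (x * l.prod) - expLinear δ (L.pass (x * l.prod)) := by
      have h2 := le_expLinear_sub_of_le hδ0.le (by linarith) (τ := τ) (D := D)
        (s := L.Λ (x * l.prod)) (by nlinarith) (by linarith [(abs_le.1 hend).1])
      have h3 := hmono hpass
      have h4 := hlevel _ hend
      linarith
    have hqq : q ^ N ≤ q ^ l.length := pow_le_pow_of_le_one hq.le hq1 hl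
    have hδc : 0 ≤ δ / 6 * c := by positivity
    have h5 := mul_le_mul hqq hgain hδc (pow_nonneg hq.le _)
    have h6 : χ x = expLinear δ τ + c * (δ * (δ * B ^ 2)) := by simp only [χ, τ]; ring
    rw [h6, hδB2] at key
    rw [heq]
    linarith

/-- A nonnegative harmonic function close to `Λ` on the component of `1` in `{Λ ≥ 0}` and bounded
elsewhere. -/
lemma exists_harmonic_near_pass {k : G} (hk : k ∈ K) (h1 : 1 ≤ L.Λ 1) (hk1 : ¬ L.Conn 0 1 k) :
    ∃ (h : G → ℝ) (B : ℝ), (∀ x, W.avg h x = h x) ∧ (∀ x, max (L.pass x) 0 ≤ h x) ∧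
      ∀ x, h x ≤ max (L.pass x) 0 + B := by
  obtain ⟨δ, hδ, hbar⟩ := L.exists_barrier hk h1 hk1
  obtain ⟨h, h1, h2, h3⟩ := W.exists_harmonic_of_subharmonic
    (f := fun x => 0 + δ * max (L.pass x) 0) (u := fun x => expLinear δ (L.pass x))
    (fun x => by
      rw [W.avg_affine]
      have := mul_le_mul_of_nonneg_left (L.le_avg_max_pass x) hδ.le
      linarith)
    (W.iterate_avg_le_of_superharmonic
      (fun x => by
        rw [W.avg_affine]
        have := mul_le_mul_of_nonneg_left (L.le_avg_max_pass x) hδ.le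
        linarith)
      (fun x => by rw [zero_add]; exact mul_max_le_expLinear _) hbar)
  refine ⟨fun x => 0 + δ⁻¹ * h x, δ⁻¹, fun x => by rw [W.avg_affine, h1], fun x => ?_, fun x => ?_⟩
  · simp only [zero_add]
    rw [inv_mul_eq_div, le_div_iff₀ hδ]
    linarith [h2 x]
  · have := (h3 x).trans (expLinear_le_mul_max hδ.le _)
    simp only [zero_add]
    rw [inv_mul_eq_div, div_le_iff₀ hδ, add_mul, inv_mul_cancel₀ hδ.ne']
    linarith

/-- A disconnected half-space gives a nonnegative harmonic function of linear growth that is not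
`K`-invariant. -/
lemma exists_harmonic_of_not_conn {k : G} (hk : k ∈ K) {c : ℝ} (hc : 1 ≤ c)
    (hct : L.Conn (L.Λ 1 - c) 1 L.t) (hk1 : ¬ L.Conn (L.Λ 1 - c) 1 k) :
    ∃ (h : G → ℝ) (B : ℝ), (∀ x, W.avg h x = h x) ∧ (∀ x, 0 ≤ h x) ∧
      (∀ x, h x ≤ |L.Λ x| + B) ∧ ∃ x, h (k * x) ≠ h x := by
  set b : ℝ := c - L.Λ 1 with hb
  have hb0 : L.Λ 1 - c + b = 0 := by rw [hb]; ring
  have ht0 : (L.shift b).Conn 0 1 L.t := hb0 ▸ hct.shift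
  have hk0 : ¬ (L.shift b).Conn 0 1 k := fun h => hk1 (Conn.of_shift (c := b) (hb0 ▸ h))
  have h11 : 1 ≤ (L.shift b).Λ 1 := by simp only [shift]; linarith
  -- The path from `1` to `t` is translated upwards by powers of `t`.
  have htn : ∀ n : ℕ, (L.shift b).Conn 0 1 (L.t ^ n) := by
    intro n
    induction n with
    | zero => rw [pow_zero]; exact Relation.ReflTransGen.refl
    | succ n ih =>
      have := (ih.translate (L.shift b).t_mul).mono (b := 0) (by norm_num)
      rw [pow_succ']
      refine ht0.trans ?_
      rwa [mul_one] at this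
  obtain ⟨h, B, h1, h2, h3⟩ := (L.shift b).exists_harmonic_near_pass hk h11 hk0
  refine ⟨h, |b| + B, h1, fun x => (le_max_right _ _).trans (h2 x), fun x => ?_, ?_⟩
  · have h4 : max ((L.shift b).pass x) 0 ≤ |b + L.Λ x| :=
      max_le (((L.shift b).pass_le x).trans (le_abs_self _)) (abs_nonneg _)
    linarith [h3 x, abs_add_le b (L.Λ x)]
  · obtain ⟨n, hn⟩ := exists_nat_gt B
    refine ⟨L.t ^ n, fun heq => ?_⟩
    have hΛ : (L.shift b).Λ (L.t ^ n) = c + n := by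
      have := (L.shift b).zpow_mul n 1
      simp only [shift, mul_one, zpow_natCast] at this ⊢
      rw [this, hb]; push_cast; ring
    have h5 := (le_max_left _ _).trans (h2 (L.t ^ n))
    rw [pass_eq (htn n).symm, hΛ] at h5
    -- `k * t ^ n` lies in the component of `k`, which is not that of `1`.
    have h6 : (L.shift b).pass (k * L.t ^ n) ≤ 0 := by
      by_contra! hpos
      have h7 := (htn n).translate (g := k) (m := 0) fun z => by rw [(L.shift b).ker_mul k hk, add_zero]
      rw [mul_one, add_zero] at h7
      exact hk0 (h7.trans (conn_of_pass_pos hpos)).symm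
    have h7 := h3 (k * L.t ^ n)
    rw [max_eq_right h6] at h7
    linarith

end HarmonicLevel

/-! ### Finite generation of `K` from connected half-spaces. -/

section Conjugates

variable {G : Type*} [Group G]

/-- The conjugates `t ^ n * e * t ^ (-n)` of the elements `e` of `A` with `n` in `I`. -/
def conjugatesBy (t : G) (A : Set G) (I : Set ℤ) : Set G :=
  {y | ∃ e ∈ A, ∃ n ∈ I, y = t ^ n * e * t ^ (-n)}

lemma conjugatesBy_mono {t : G} {A A' : Set G} {I I' : Set ℤ} (hA : A ⊆ A') (hI : I ⊆ I') :
    conjugatesBy t A I ⊆ conjugatesBy t A' I' := by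
  rintro _ ⟨e, he, n, hn, rfl⟩
  exact ⟨e, hA he, n, hI hn, rfl⟩

lemma conjugatesBy_finite {t : G} {A : Set G} {I : Set ℤ} (hA : A.Finite) (hI : I.Finite) :
    (conjugatesBy t A I).Finite := by
  refine (Set.Finite.image2 (fun e (n : ℤ) => t ^ n * e * t ^ (-n)) hA hI).subset ?_
  rintro _ ⟨e, he, n, hn, rfl⟩
  exact ⟨e, he, n, hn, rfl⟩

lemma closure_conjugatesBy_le {K : Subgroup G} [K.Normal] {t : G} {A : Set G} (hA : A ⊆ K)
    (I : Set ℤ) : Subgroup.closure (conjugatesBy t A I) ≤ K := by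
  rw [Subgroup.closure_le]
  rintro _ ⟨e, he, n, -, rfl⟩
  rw [zpow_neg]
  exact Subgroup.Normal.conj_mem inferInstance e (hA he) _

/-- A normal subgroup generated by the conjugates of a finite set by the large powers of `t`, and
also by its conjugates by the small powers, is finitely generated. -/
lemma Subgroup.fg_of_le_closure_conjugatesBy {K : Subgroup G} [K.Normal] {t : G} {A : Set G}
    (hAfin : A.Finite) (hA : A ⊆ K) (m : ℕ)
    (hup : K ≤ closure (conjugatesBy t A (Set.Ici (-m))))
    (hdown : K ≤ closure (conjugatesBy t A (Set.Iic m))) : K.FG := by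
  have hdir : ∀ x ∈ closure (conjugatesBy t A (Set.Ici (-m))),
      ∃ N : ℕ, x ∈ closure (conjugatesBy t A (Set.Icc (-m) N)) := by
    intro x hx
    have hmono : ∀ {a b : ℕ}, a ≤ b → closure (conjugatesBy t A (Set.Icc (-m) a)) ≤
        closure (conjugatesBy t A (Set.Icc (-m) b)) := fun h =>
      closure_mono (conjugatesBy_mono subset_rfl (Set.Icc_subset_Icc_right (by exact_mod_cast h)))
    induction hx using closure_induction with
    | mem x hx =>
      obtain ⟨e, he, n, hn, rfl⟩ := hx
      exact ⟨n.toNat, subset_closure ⟨e, he, n, ⟨hn, Int.self_le_toNat n⟩, rfl⟩⟩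
    | one => exact ⟨0, one_mem _⟩
    | mul x y _ _ hx hy =>
      obtain ⟨a, ha⟩ := hx
      obtain ⟨b, hb⟩ := hy
      exact ⟨max a b, mul_mem (hmono (le_max_left _ _) ha) (hmono (le_max_right _ _) hb)⟩
    | inv x _ hx =>
      obtain ⟨a, ha⟩ := hx
      exact ⟨a, inv_mem ha⟩
  -- By normality the conjugates by `t ^ (-m - 1)` lie in `K`, and as `A` is finite one exponent
  -- window `[-m, N]` generates them all. The resulting group `B` is stable under `y ↦ t⁻¹ * y * t`,
  -- so it contains every conjugate with exponent at most `m`.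
  have hex : ∀ e ∈ A, ∃ N : ℕ, t ^ (-(m : ℤ) - 1) * e * t ^ (-(-(m : ℤ) - 1)) ∈
      closure (conjugatesBy t A (Set.Icc (-m) N)) := fun e he => hdir _ (hup (by
        rw [zpow_neg t (-(m : ℤ) - 1)]
        exact Subgroup.Normal.conj_mem inferInstance e (hA he) _))
  choose! Nf hNf using hex
  obtain ⟨N₀, hN₀⟩ := (hAfin.image Nf).bddAbove
  set N : ℕ := max N₀ m
  set B := closure (conjugatesBy t A (Set.Icc (-m) N)) with hB
  have hBase : ∀ e ∈ A, t ^ (-(m : ℤ) - 1) * e * t ^ (-(-(m : ℤ) - 1)) ∈ B := fun e he =>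
    closure_mono (conjugatesBy_mono subset_rfl (Set.Icc_subset_Icc_right (by
      exact_mod_cast (hN₀ ⟨e, he, rfl⟩).trans (le_max_left _ _)))) (hNf e he)
  have hconj : ∀ y ∈ B, t⁻¹ * y * t ∈ B := by
    suffices h : B ≤ B.comap (MulAut.conj t⁻¹).toMonoidHom by
      intro y hy
      simpa using h hy
    conv_lhs => rw [hB]
    rw [closure_le]
    rintro _ ⟨e, he, n, hn, rfl⟩
    have hrew : t⁻¹ * (t ^ n * e * t ^ (-n)) * t = t ^ (n - 1) * e * t ^ (-(n - 1)) := by group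
    simp only [SetLike.mem_coe, mem_comap, MulEquiv.coe_toMonoidHom, MulAut.conj_apply, inv_inv]
    rw [hrew]
    rcases hn.1.lt_or_eq with h | h
    · exact subset_closure ⟨e, he, n - 1, ⟨by omega, by have := hn.2; omega⟩, rfl⟩
    · rw [← h]; exact hBase e he
  have hall : ∀ e ∈ A, ∀ j : ℕ, t ^ ((m : ℤ) - j) * e * t ^ (-((m : ℤ) - j)) ∈ B := by
    intro e he j
    induction j with
    | zero =>
      refine subset_closure ⟨e, he, m, ⟨by omega, ?_⟩, by simp⟩
      exact_mod_cast le_max_right N₀ m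
    | succ j ih =>
      have := hconj _ ih
      convert this using 1
      push_cast
      group
  refine (Subgroup.fg_iff K).2 ⟨conjugatesBy t A (Set.Icc (-m) N), ?_,
    conjugatesBy_finite hAfin (Set.finite_Icc _ _)⟩
  refine (closure_conjugatesBy_le hA _).antisymm (hdown.trans ((closure_le _).2 ?_))
  rintro _ ⟨e, he, n, hn, rfl⟩
  have := hall e he (m - n).toNat
  rwa [Int.toNat_of_nonneg (by simpa using hn), sub_sub_cancel] at this

end Conjugates

namespace HarmonicLevel

variable {G : Type*} [Group G] {W : FiniteWalk G} {K : Subgroup G} [K.Normal]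

/-- If all of `K` is connected to `1` in a half-space, then `K` is generated by the conjugates of a
finite set by the large powers of `t`. -/
lemma exists_le_closure_of_conn (L : HarmonicLevel W K) {a : ℝ} (h : ∀ k ∈ K, L.Conn a 1 k) :
    ∃ A : Set G, A.Finite ∧ A ⊆ K ∧ ∃ m : ℕ,
      K ≤ Subgroup.closure (conjugatesBy L.t A (Set.Ici (-m))) := by
  classical
  choose kf hkf nf rf hrf hdec using L.decomp
  obtain ⟨m, hm⟩ : ∃ m : ℕ, ∀ r ∈ L.reps, |L.Λ r| + |a| + |L.Λ 1| ≤ m := by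
    obtain ⟨B, hB⟩ := (L.reps.image fun r => |L.Λ r| + |a| + |L.Λ 1|).bddAbove
    refine ⟨⌈B⌉₊, fun r hr => (hB ?_).trans (Nat.le_ceil B)⟩
    simp only [Finset.coe_image, Set.mem_image, SetLike.mem_coe]
    exact ⟨r, hr, rfl⟩
  -- `A₁` holds Schreier-type generators, which record one edge of a path each; `A₂` holds the
  -- possible remainders `t ^ n * r` when a path ends in `K`.
  let A₁ : Finset G := insert (kf 1) (Finset.image₂ (fun r s => kf (r * s)) L.reps W.S)
  let A₂ : Finset G := (Finset.image₂ (fun r (n : ℤ) => L.t ^ n * r) L.reps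
    (Finset.Icc (-m : ℤ) m)).filter (· ∈ K)
  have hA : ((A₁ ∪ A₂ : Finset G) : Set G) ⊆ K := by
    intro e he
    simp only [A₁, A₂, Finset.coe_union, Finset.coe_insert, Finset.coe_image₂, Finset.coe_filter,
      Set.mem_union, Set.mem_insert_iff, Set.mem_image2, Set.mem_ofPred_eq] at he
    rcases he with (rfl | ⟨r, -, s, -, rfl⟩) | ⟨-, h⟩
    · exact hkf _
    · exact hkf _
    · exact h
  refine ⟨(A₁ ∪ A₂ : Finset G), Finset.finite_toSet _, hA, m, fun k hk => ?_⟩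
  set Γ := Subgroup.closure (conjugatesBy L.t ((A₁ ∪ A₂ : Finset G) : Set G) (Set.Ici (-m)))
  have hΓK : Γ ≤ K := closure_conjugatesBy_le hA _
  have hmem : ∀ e ∈ A₁ ∪ A₂, ∀ n : ℤ, -m ≤ n → L.t ^ n * e * L.t ^ (-n) ∈ Γ := fun e he n hn =>
    Subgroup.subset_closure ⟨e, he, n, hn, rfl⟩
  have hmem' : ∀ e ∈ A₁ ∪ A₂, e ∈ Γ := fun e he => by simpa using hmem e he 0 (by simp)
  have hpath : ∀ y, L.Conn a 1 y → ∃ κ ∈ Γ, ∃ n : ℤ, ∃ r ∈ L.reps, y = κ * L.t ^ n * r := by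
    intro y hy
    induction hy with
    | refl => exact ⟨kf 1, hmem' _ (by simp [A₁]), nf 1, rf 1, hrf 1, hdec 1⟩
    | tail _ hstep ih =>
      obtain ⟨κ, hκ, n, r, hr, rfl⟩ := ih
      obtain ⟨ha, -, s, hs, rfl⟩ := hstep
      rw [mul_assoc, L.ker_mul κ (hΓK hκ), L.zpow_mul] at ha
      -- Staying above level `a` bounds the exponent of `t` from below.
      have hn : (-m : ℤ) ≤ n := by
        have : (-m : ℝ) ≤ n := by
          have := hm r hr
          have := le_abs_self (L.Λ r)
          have := neg_abs_le a
          have := abs_nonneg (L.Λ 1)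
          linarith
        exact_mod_cast this
      refine ⟨κ * (L.t ^ n * kf (r * s) * L.t ^ (-n)), mul_mem hκ (hmem _ ?_ n hn),
        n + nf (r * s), rf (r * s), hrf _, ?_⟩
      · simp only [A₁, Finset.mem_union, Finset.mem_insert, Finset.mem_image₂]
        exact Or.inl (Or.inr ⟨r, hr, s, hs, rfl⟩)
      · calc κ * L.t ^ n * r * s = κ * L.t ^ n * (r * s) := mul_assoc _ _ _
          _ = κ * L.t ^ n * (kf (r * s) * L.t ^ nf (r * s) * rf (r * s)) :=
            congrArg _ (hdec (r * s))
          _ = _ := by group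
  obtain ⟨κ, hκ, n, r, hr, hkeq⟩ := hpath k (h k hk)
  have hrK : L.t ^ n * r ∈ K := by
    have : L.t ^ n * r = κ⁻¹ * k := by rw [hkeq]; group
    rw [this]
    exact mul_mem (inv_mem (hΓK hκ)) hk
  have hn : L.Λ r + n = L.Λ 1 := by
    rw [← L.zpow_mul]
    simpa using L.ker_mul _ hrK 1
  rw [hkeq, mul_assoc]
  refine mul_mem hκ (hmem' _ ?_)
  have hn' : |(n : ℝ)| ≤ m := by
    rw [show (n : ℝ) = L.Λ 1 - L.Λ r by linarith]
    have := hm r hr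
    have := abs_nonneg a
    have := abs_sub (L.Λ 1) (L.Λ r)
    linarith
  have hn2 : |n| ≤ (m : ℤ) := by exact_mod_cast hn'
  simp only [A₂, Finset.mem_union, Finset.mem_filter, Finset.mem_image₂, Finset.mem_Icc]
  exact Or.inr ⟨⟨r, hr, n, abs_le.1 hn2, rfl⟩, hrK⟩

/-- If `K` is not finitely generated, then one of the two directions has disconnected
half-spaces. -/
lemma exists_not_conn (L : HarmonicLevel W K) (hK : ¬ K.FG) (a b : ℝ) :
    (∃ k ∈ K, ¬ L.Conn a 1 k) ∨ ∃ k ∈ K, ¬ L.neg.Conn b 1 k := by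
  by_contra! hcon
  obtain ⟨A, hAf, hA, m, hm⟩ := L.exists_le_closure_of_conn hcon.1
  obtain ⟨A', hAf', hA', m', hm'⟩ := L.neg.exists_le_closure_of_conn hcon.2
  refine hK (Subgroup.fg_of_le_closure_conjugatesBy (hAf.union hAf') (Set.union_subset hA hA')
    (max m m') (t := L.t) (hm.trans (Subgroup.closure_mono ?_))
    (hm'.trans (Subgroup.closure_mono ?_)))
  · refine conjugatesBy_mono Set.subset_union_left (Set.Ici_subset_Ici.2 ?_)
    push_cast
    exact neg_le_neg (le_max_left _ _)
  · rintro _ ⟨e, he, n, hn, rfl⟩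
    refine ⟨e, Or.inr he, -n, ?_, by simp [neg]⟩
    have : -(m' : ℤ) ≤ n := hn
    simp only [Set.mem_Iic]
    push_cast
    have := le_max_right (m : ℤ) m'
    omega

/-- If `K` is not finitely generated, then there is a nonnegative harmonic function of linear growth
that is not `K`-invariant. -/
lemma exists_harmonic (L : HarmonicLevel W K) (hK : ¬ K.FG) :
    ∃ (h : G → ℝ) (B : ℝ), (∀ x, W.avg h x = h x) ∧ (∀ x, 0 ≤ h x) ∧
      (∀ x, h x ≤ |L.Λ x| + B) ∧ ∃ k ∈ K, ∃ x, h (k * x) ≠ h x := by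
  have hc : ∀ L : HarmonicLevel W K, ∃ c, 1 ≤ c ∧ L.Conn (L.Λ 1 - c) 1 L.t := by
    intro L
    obtain ⟨a, ha⟩ := L.exists_conn 1 L.t
    exact ⟨max 1 (L.Λ 1 - a), le_max_left _ _,
      ha.mono (by linarith [le_max_right 1 (L.Λ 1 - a)])⟩
  obtain ⟨c, hc1, hct⟩ := hc L
  obtain ⟨c', hc1', hct'⟩ := hc L.neg
  rcases L.exists_not_conn hK (L.Λ 1 - c) (L.neg.Λ 1 - c') with ⟨k, hk, hn⟩ | ⟨k, hk, hn⟩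
  · obtain ⟨h, B, h1, h2, h3, h4⟩ := L.exists_harmonic_of_not_conn hk hc1 hct hn
    exact ⟨h, B, h1, h2, h3, k, hk, h4⟩
  · obtain ⟨h, B, h1, h2, h3, h4⟩ := L.neg.exists_harmonic_of_not_conn hk hc1' hct' hn
    exact ⟨h, B, h1, h2, fun x => by simpa [neg] using h3 x, k, hk, h4⟩

end HarmonicLevel

/-! ### Construction of the harmonic level function. -/

namespace FiniteWalk

variable {G : Type*} [Group G] (W : FiniteWalk G)

/-- The Poisson equation on a finite transitive `G`-set is solvable for right-hand sides of sum
zero. -/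
lemma exists_poisson {Q : Type*} [Fintype Q] [MulAction G Q] [MulAction.IsPretransitive G Q]
    (d : Q → ℝ) (hd : ∑ q, d q = 0) :
    ∃ r : Q → ℝ, ∀ q, r q - ∑ s ∈ W.S, W.p s * r (s⁻¹ • q) = d q := by
  classical
  let T : (Q → ℝ) →ₗ[ℝ] (Q → ℝ) :=
    { toFun := fun r q => r q - ∑ s ∈ W.S, W.p s * r (s⁻¹ • q)
      map_add' := fun r r' => by
        ext q
        simp only [Pi.add_apply, mul_add, Finset.sum_add_distrib]
        ring
      map_smul' := fun c r => by
        ext q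
        simp only [Pi.smul_apply, smul_eq_mul, RingHom.id_apply, mul_sub, Finset.mul_sum]
        congr 1
        exact Finset.sum_congr rfl fun s _ => by ring }
  suffices h : d ∈ LinearMap.range T by
    obtain ⟨r, hr⟩ := h
    exact ⟨r, fun q => congrFun hr q⟩
  by_contra hnot
  -- A functional `φ` killing the range of `T` is tested on its own vector `v`: the Dirichlet energy
  -- of `v` vanishes, so `v` is constant by transitivity and `φ d = 0`.
  obtain ⟨φ, hφd, hφ⟩ := Submodule.exists_le_ker_of_notMem hnot
  let v : Q → ℝ := fun q => φ fun j => if q = j then 1 else 0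
  have hrepr : ∀ f, φ f = ∑ q, f q * v q := fun f => LinearMap.pi_apply_eq_sum_univ φ f
  have hzero : ∑ q, T v q * v q = 0 := by
    rw [← hrepr]
    exact hφ ⟨v, rfl⟩
  have henergy : ∑ s ∈ W.S, W.p s * ∑ q, (v q - v (s⁻¹ • q)) ^ 2 = 0 := by
    have h1 : ∀ s : G, ∑ q, (v q - v (s⁻¹ • q)) ^ 2 =
        2 * ∑ q, v q ^ 2 - 2 * ∑ q, v (s⁻¹ • q) * v q := by
      intro s
      have h2 : ∑ q, v (s⁻¹ • q) ^ 2 = ∑ q, v q ^ 2 :=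
        Equiv.sum_comp (MulAction.toPerm s⁻¹) fun q => v q ^ 2
      calc ∑ q, (v q - v (s⁻¹ • q)) ^ 2
          = ∑ q, (v q ^ 2 + v (s⁻¹ • q) ^ 2 - 2 * (v (s⁻¹ • q) * v q)) :=
            Finset.sum_congr rfl fun q _ => by ring
        _ = _ := by
            rw [Finset.sum_sub_distrib, Finset.sum_add_distrib, h2, ← Finset.mul_sum]; ring
    have h3 : ∑ q, T v q * v q =
        ∑ q, v q ^ 2 - ∑ s ∈ W.S, W.p s * ∑ q, v (s⁻¹ • q) * v q := by
      simp only [T, LinearMap.coe_mk, AddHom.coe_mk, sub_mul, Finset.sum_sub_distrib,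
        Finset.sum_mul, Finset.mul_sum]
      rw [Finset.sum_comm]
      congr 1
      · exact Finset.sum_congr rfl fun q _ => by ring
      · exact Finset.sum_congr rfl fun s _ => Finset.sum_congr rfl fun q _ => by ring
    simp only [h1, mul_sub, Finset.sum_sub_distrib]
    rw [← Finset.sum_mul, W.sum_p, one_mul]
    have h4 : ∑ s ∈ W.S, W.p s * (2 * ∑ q, v (s⁻¹ • q) * v q) =
        2 * ∑ s ∈ W.S, W.p s * ∑ q, v (s⁻¹ • q) * v q := by
      rw [Finset.mul_sum]
      exact Finset.sum_congr rfl fun s _ => by ring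
    rw [h4]
    linarith
  have hstep : ∀ s ∈ W.S, ∀ q, v (s • q) = v q := by
    intro s hs q
    have h1 := (Finset.sum_eq_zero_iff_of_nonneg fun s hs => mul_nonneg (W.p_pos s hs).le
      (Finset.sum_nonneg fun q _ => sq_nonneg _)).1 henergy s hs
    have h2 := (mul_eq_zero.1 h1).resolve_left (W.p_pos s hs).ne'
    have h3 := (Finset.sum_eq_zero_iff_of_nonneg fun q _ => sq_nonneg _).1 h2 (s • q)
      (Finset.mem_univ _)
    rw [inv_smul_smul] at h3
    exact sub_eq_zero.1 (pow_eq_zero_iff two_ne_zero |>.1 h3)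
  have hconst : ∀ g : G, ∀ q, v (g • q) = v q := by
    intro g
    obtain ⟨l, hl, rfl⟩ := W.exists_word g
    induction l with
    | nil => simp
    | cons s l ih =>
      intro q
      rw [List.prod_cons, mul_smul, hstep s (hl s (by simp)),
        ih (fun s hs => hl s (by simp [hs]))]
  refine hφd ?_
  rw [hrepr]
  rcases isEmpty_or_nonempty Q with hQ | ⟨⟨q₀⟩⟩
  · simp
  · have : ∀ q, v q = v q₀ := fun q => by
      obtain ⟨g, rfl⟩ := MulAction.exists_smul_eq G q₀ q
      exact hconst g q₀
    simp only [this]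
    rw [← Finset.sum_mul, hd, zero_mul]

end FiniteWalk

/-- In an infinite group with a cyclic subgroup `C` of finite index, generated by `z`, every `h` is
`z ^ N * q⁻¹` for a representative `q` of the coset of `h⁻¹`. -/
lemma exists_zpow_of_isCyclic_finiteIndex {H : Type*} [Group H] [Infinite H] (C : Subgroup H)
    (hC : IsCyclic C) [C.FiniteIndex] :
    ∃ z ∈ C, ∃ N : H → ℤ, (∀ h, N (z * h) = N h + 1) ∧
      ∀ h, h = z ^ N h * (Quotient.out ((h⁻¹ : H) : H ⧸ C))⁻¹ := by
  obtain ⟨⟨z, hz⟩, hgen⟩ := hC.exists_generator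
  have hinf : Infinite C := by
    by_contra hfin
    rw [not_infinite_iff_finite] at hfin
    have : Finite (H ⧸ C) := inferInstance
    have : Finite H := Finite.of_equiv _ (Subgroup.groupEquivQuotientProdSubgroup (s := C)).symm
    exact not_finite H
  have hinj : Function.Injective fun n : ℤ => z ^ n := by
    have h1 : ¬ IsOfFinOrder (⟨z, hz⟩ : C) := by
      intro h
      have h2 : (Subgroup.zpowers (⟨z, hz⟩ : C) : Set C).Finite := h.finite_zpowers
      refine Set.infinite_univ (α := C) (h2.subset fun x _ => hgen x)
    intro a b hab
    refine injective_zpow_iff_not_isOfFinOrder.2 h1 (Subtype.ext ?_)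
    simpa using hab
  have hex : ∀ h : H, ∃ n : ℤ, h = z ^ n * (Quotient.out ((h⁻¹ : H) : H ⧸ C))⁻¹ := by
    intro h
    have h1 : h * Quotient.out ((h⁻¹ : H) : H ⧸ C) ∈ C := by
      have := QuotientGroup.eq.1 (QuotientGroup.out_eq' ((h⁻¹ : H) : H ⧸ C)).symm
      simpa using this
    obtain ⟨n, hn⟩ := Subgroup.mem_zpowers_iff.1 (hgen ⟨_, h1⟩)
    refine ⟨n, ?_⟩
    have := congrArg Subtype.val hn
    simp only [SubgroupClass.coe_zpow] at this
    rw [this]; group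
  choose N hN using hex
  refine ⟨z, hz, N, fun h => ?_, hN⟩
  have hq : (((z * h)⁻¹ : H) : H ⧸ C) = ((h⁻¹ : H) : H ⧸ C) := by
    rw [QuotientGroup.eq]; simpa using hz
  apply hinj
  have h1 := hN (z * h)
  rw [hq] at h1
  conv_lhs at h1 => rw [hN h]
  rw [← mul_assoc] at h1
  have := mul_right_cancel h1
  simp only
  rw [← this, zpow_add, zpow_one, ← zpow_one_add, ← zpow_add_one, add_comm]

/-- The increments of `N ∘ ψ` depend only on the step and on a point of the finite coset space.
Their mean `d` sums to zero over the cosets, so a Poisson solution `r` corrects `N ∘ ψ` to a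
harmonic function. -/
lemma exists_harmonicLevel {G H : Type*} [Group G] [Group H] [Infinite H] (W : FiniteWalk G)
    (ψ : G →* H) (hψ : Function.Surjective ψ) (C : Subgroup H) (hC : IsCyclic C)
    [C.FiniteIndex] : Nonempty (HarmonicLevel W ψ.ker) := by
  classical
  obtain ⟨z, hz, N, hNz, hN⟩ := exists_zpow_of_isCyclic_finiteIndex C hC
  have hNpow : ∀ (n : ℤ) h, N (z ^ n * h) = N h + n := by
    intro n h
    induction n with
    | zero => simp
    | succ n ih => rw [add_comm, zpow_add, zpow_one, mul_assoc, hNz, ih]; ring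
    | pred n ih =>
      have := hNz (z ^ (-(n : ℤ) - 1) * h)
      rw [← mul_assoc, ← zpow_one_add, add_sub_cancel, ih] at this
      linarith
  let _ : MulAction G (H ⧸ C) := MulAction.compHom (H ⧸ C) ψ
  have hsmul : ∀ (g : G) (q : H ⧸ C), g • q = ψ g • q := fun _ _ => rfl
  have : MulAction.IsPretransitive G (H ⧸ C) := ⟨fun a b => by
    obtain ⟨g, hg⟩ := MulAction.exists_smul_eq H a b
    obtain ⟨x, rfl⟩ := hψ g
    exact ⟨x, hg⟩⟩
  let _ : Fintype (H ⧸ C) := Fintype.ofFinite _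
  let cos : G → H ⧸ C := fun x => ((ψ x)⁻¹ : H)
  have hcos_mul : ∀ x s, cos (x * s) = s⁻¹ • cos x := fun x s => by
    simp only [cos, hsmul, map_mul, map_inv, mul_inv_rev]; rfl
  let inc : G → H ⧸ C → ℤ := fun s q => N ((Quotient.out q)⁻¹ * ψ s)
  have hinc : ∀ h s, N (h * ψ s) = N h + inc s ((h⁻¹ : H) : H ⧸ C) := fun h s => by
    conv_lhs => rw [hN h, mul_assoc, hNpow, add_comm]
  have hinc_inv : ∀ s q, inc s⁻¹ (s⁻¹ • q) = -inc s q := fun s q => by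
    have h1 := hinc (Quotient.out q)⁻¹ s
    have h2 := hinc ((Quotient.out q)⁻¹ * ψ s) s⁻¹
    have h3 : ((((Quotient.out q)⁻¹ * ψ s)⁻¹ : H) : H ⧸ C) = s⁻¹ • q := by
      rw [hsmul, mul_inv_rev, inv_inv, ← map_inv]
      conv_rhs => rw [← QuotientGroup.out_eq' q]
      rfl
    rw [h3, map_inv, mul_inv_cancel_right] at h2
    rw [inv_inv, QuotientGroup.out_eq'] at h1
    linarith
  let d : H ⧸ C → ℝ := fun q => ∑ s ∈ W.S, W.p s * inc s q
  -- Reversing an edge negates its increment, and the symmetry of the walk pairs each edge with its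
  -- reverse.
  have hd : ∑ q, d q = 0 := by
    let I : G → ℝ := fun s => ∑ q, (inc s q : ℝ)
    have hI : ∀ s, I s⁻¹ = -I s := fun s => by
      simp only [I]
      rw [← Equiv.sum_comp (MulAction.toPerm s⁻¹) fun q => (inc s⁻¹ q : ℝ),
        ← Finset.sum_neg_distrib]
      refine Finset.sum_congr rfl fun q _ => ?_
      rw [MulAction.toPerm_apply, hinc_inv]
      push_cast; ring
    have h1 : ∑ q, d q = ∑ s ∈ W.S, W.p s * I s := by
      simp only [d, I, Finset.mul_sum]
      exact Finset.sum_comm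
    have h2 : ∑ s ∈ W.S, W.p s * I s = ∑ s ∈ W.S, W.p s⁻¹ * I s⁻¹ :=
      Finset.sum_nbij' (·⁻¹) (·⁻¹) W.inv_mem W.inv_mem (by simp) (by simp) (by simp)
    have h3 : ∑ s ∈ W.S, W.p s⁻¹ * I s⁻¹ = -∑ s ∈ W.S, W.p s * I s := by
      rw [← Finset.sum_neg_distrib]
      exact Finset.sum_congr rfl fun s _ => by rw [W.p_inv, hI]; ring
    rw [h1]
    linarith
  obtain ⟨r, hr⟩ := W.exists_poisson d hd
  let Λ : G → ℝ := fun x => N (ψ x) + r (cos x)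
  have hΛs : ∀ x s, Λ (x * s) = Λ x + (inc s (cos x) + r (s⁻¹ • cos x) - r (cos x)) :=
    fun x s => by
      simp only [Λ]
      rw [hcos_mul, map_mul, hinc]
      push_cast
      ring
  obtain ⟨t, ht⟩ := hψ z
  let R : ℝ := ∑ s ∈ W.S, ∑ q, |(inc s q : ℝ) + r (s⁻¹ • q) - r q|
  choose σ hσ using hψ
  refine ⟨⟨Λ, t, R, Finset.univ.image fun q : H ⧸ C => σ (Quotient.out q)⁻¹,
    fun x => ?_, fun k hk x => ?_, fun x => ?_, fun x s hs => ?_, fun x => ?_⟩⟩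
  · have h1 := hr (cos x)
    simp only [FiniteWalk.avg, hΛs, mul_add, mul_sub, Finset.sum_add_distrib,
      Finset.sum_sub_distrib]
    rw [← Finset.sum_mul, ← Finset.sum_mul, W.sum_p]
    simp only [d] at h1
    linarith
  · have h1 : ψ (k * x) = ψ x := by rw [map_mul, MonoidHom.mem_ker.1 hk, one_mul]
    simp only [Λ, cos, h1]
  · have h1 : cos (t * x) = cos x := by
      simp only [cos, map_mul, ht]
      rw [QuotientGroup.eq]; simpa using hz
    simp only [Λ]
    rw [h1, map_mul, ht, hNz]
    push_cast; ring
  · rw [hΛs, add_sub_cancel_left]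
    refine (Finset.single_le_sum (f := fun q => |(inc s q : ℝ) + r (s⁻¹ • q) - r q|)
      (fun q _ => abs_nonneg _) (Finset.mem_univ (cos x))).trans ?_
    exact Finset.single_le_sum
      (f := fun s => ∑ q, |(inc s q : ℝ) + r (s⁻¹ • q) - r q|)
      (fun s _ => Finset.sum_nonneg fun q _ => abs_nonneg _) hs
  · refine ⟨x * (σ (Quotient.out (cos x))⁻¹)⁻¹ * (t ^ N (ψ x))⁻¹, ?_, N (ψ x), _,
      Finset.mem_image_of_mem _ (Finset.mem_univ (cos x)), by group⟩
    rw [MonoidHom.mem_ker, map_mul, map_mul, map_inv, map_inv, map_zpow, hσ, ht, inv_inv,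
      mul_inv_eq_one]
    exact eq_mul_inv_iff_mul_eq.1 (hN (ψ x))

/-! ### From the measure `μ` to the finite walk, and the conclusion. -/

namespace RWGroup

variable {G : Type*} [Group G] {μ : PMF G}

lemma exists_word_of_isGenerating (hgen : IsGenerating μ) (g : G) :
    ∃ w : List G, (∀ s ∈ w, s ∈ μ.support) ∧ w.prod = g := by
  have hg : g ∈ Subsemigroup.closure μ.support := by rw [hgen]; trivial
  induction hg using Subsemigroup.closure_induction with
  | mem s hs => exact ⟨[s], by simpa using hs, by simp⟩
  | mul x y _ _ hx hy =>
    obtain ⟨w, hw, rfl⟩ := hx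
    obtain ⟨w', hw', rfl⟩ := hy
    refine ⟨w ++ w', fun s hs => ?_, by simp⟩
    rcases List.mem_append.1 hs with h | h
    exacts [hw s h, hw' s h]

/-- The finite walk with the step distribution `μ`. -/
noncomputable def toFiniteWalk (hfin : μ.support.Finite) (hsymm : IsSymmetric μ)
    (hgen : IsGenerating μ) : FiniteWalk G where
  S := hfin.toFinset
  p s := (μ s).toReal
  p_pos s hs := ENNReal.toReal_pos ((PMF.mem_support_iff _ _).1 (hfin.mem_toFinset.1 hs))
    (PMF.apply_ne_top μ s)
  sum_p := by
    rw [← ENNReal.toReal_sum fun s _ => PMF.apply_ne_top μ s, ← ENNReal.toReal_one,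
      ← μ.tsum_coe, tsum_eq_sum fun s hs => ?_]
    rwa [hfin.mem_toFinset, PMF.mem_support_iff, not_not] at hs
  inv_mem s hs := by
    rw [hfin.mem_toFinset, PMF.mem_support_iff] at hs ⊢
    rwa [← hsymm s]
  p_inv s := by rw [← hsymm s]
  exists_word g := by simpa using exists_word_of_isGenerating hgen g

lemma isHarmonic_iff (hfin : μ.support.Finite) (hsymm : IsSymmetric μ) (hgen : IsGenerating μ)
    (f : G → ℝ) : IsHarmonic μ f ↔ ∀ x, (toFiniteWalk hfin hsymm hgen).avg f x = f x := by
  refine forall_congr' fun x => ?_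
  rw [laplacian, finsum_mem_eq_finite_toFinset_sum _ hfin, sub_eq_zero, eq_comm]
  rfl

lemma exists_word_length_eq (hgen : IsGenerating μ) (g : G) :
    ∃ w : List G, w.length = wordLength μ.support g ∧ (∀ s ∈ w, s ∈ μ.support) ∧ w.prod = g :=
  Nat.sInf_mem (s := {n | ∃ w : List G, w.length = n ∧ (∀ s ∈ w, s ∈ μ.support) ∧ w.prod = g})
    (let ⟨w, h⟩ := exists_word_of_isGenerating hgen g; ⟨w.length, w, rfl, h⟩)

lemma abs_sub_le_mul_wordLength (hgen : IsGenerating μ) {f : G → ℝ} {R : ℝ}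
    (hf : ∀ x, ∀ s ∈ μ.support, |f (x * s) - f x| ≤ R) (g : G) :
    |f g - f 1| ≤ R * wordLength μ.support g := by
  obtain ⟨w, hlen, hw, rfl⟩ := exists_word_length_eq hgen g
  rw [← hlen]
  clear hlen
  suffices h : ∀ x, |f (x * w.prod) - f x| ≤ R * w.length by simpa using h 1
  induction w with
  | nil => simp
  | cons s w ih =>
    intro x
    have h1 := ih (fun s hs => hw s (by simp [hs])) (x * s)
    have h2 := hf x s (hw s (by simp))
    have h3 := abs_sub_le (f (x * s * w.prod)) (f (x * s)) (f x)
    rw [List.prod_cons, ← mul_assoc, List.length_cons]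
    push_cast
    linarith

lemma one_le_wordLength (hgen : IsGenerating μ) {g : G} (hg : g ≠ 1) :
    1 ≤ wordLength μ.support g := by
  obtain ⟨w, hlen, -, rfl⟩ := exists_word_length_eq hgen g
  rw [← hlen, Nat.one_le_iff_ne_zero]
  intro h
  exact hg (by rw [List.length_eq_zero_iff.1 h, List.prod_nil])

end RWGroup

theorem mainTheorem12 {G : Type*} [Group G] (μ : PMF G)
    (hfin : μ.support.Finite) (hsymm : RWGroup.IsSymmetric μ) (hgen : RWGroup.IsGenerating μ)
    {H : Type*} [Group H] [Infinite H] (hH : RWGroup.IsVirtuallyCyclic H)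
    (ψ : G →* H) (hψ : Function.Surjective ψ) (hK : ¬ ψ.ker.FG) :
    ∃ h : G → ℝ, RWGroup.IsHarmonic μ h ∧ (∀ x : G, 0 < h x) ∧
      RWGroup.AtMostLinearGrowth μ h ∧ ¬ RWGroup.FactorsThroughQuotient ψ.ker h := by
  obtain ⟨C, hC, hCfin⟩ := hH
  set W := RWGroup.toFiniteWalk hfin hsymm hgen with hW
  obtain ⟨L⟩ := exists_harmonicLevel W ψ hψ C hC
  obtain ⟨h, B, hharm, hpos, hgrow, k, hk, x₀, hx₀⟩ := L.exists_harmonic hK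
  -- Adding 1 makes the nonnegative function strictly positive; the factor 1 fits the form of
  -- `avg_affine`.
  refine ⟨fun x => 1 + 1 * h x, (RWGroup.isHarmonic_iff hfin hsymm hgen _).2 fun x => ?_,
    fun x => by linarith [hpos x], ?_, ?_⟩
  · rw [← hW, W.avg_affine, hharm]
  · refine Asymptotics.IsBigO.of_bound (L.R + (1 + |L.Λ 1| + |B|)) ?_
    -- Away from `1` the word length is at least 1 and absorbs the additive constants.
    have h1 : ∀ᶠ x : G in Filter.cofinite, x ≠ 1 := by
      simp
    filter_upwards [h1] with x hx
    have h2 : (1 : ℝ) ≤ RWGroup.wordLength μ.support x := by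
      exact_mod_cast RWGroup.one_le_wordLength hgen hx
    have h3 := RWGroup.abs_sub_le_mul_wordLength hgen (f := L.Λ) (R := L.R)
      (fun x s hs => L.lip x s (hfin.mem_toFinset.2 hs)) x
    have h4 := abs_sub_abs_le_abs_sub (L.Λ x) (L.Λ 1)
    have h5 : 0 ≤ 1 + |L.Λ 1| + |B| := by positivity
    have h6 := le_mul_of_one_le_right h5 h2
    rw [Real.norm_of_nonneg (by linarith [hpos x]), Real.norm_of_nonneg (Nat.cast_nonneg _),
      add_mul]
    linarith [hgrow x, le_abs_self B]
  · rintro ⟨q, hq⟩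
    refine hx₀ ?_
    have h1 : (QuotientGroup.mk (k * x₀) : G ⧸ ψ.ker) = QuotientGroup.mk x₀ := by
      rw [QuotientGroup.eq, mul_inv_rev, mul_assoc]
      simpa [mul_assoc] using (inferInstance : ψ.ker.Normal).conj_mem _ (inv_mem hk) x₀⁻¹
    have h2 := (hq (k * x₀)).trans ((congrArg q h1).trans (hq x₀).symm)
    simpa using h2
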